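/- Let $\mathbb H=\{z\in\mathbb C:\operatorname{Im} z>0\}$, with pseudo-hyperbolic distance $d(z,w)=\left|\frac{w-z}{w-\overline z}\right|$. Let $\phi:\mathbb H\to\mathbb H$ be an analytic self-map of parabolic type with Denjoy–Wolff point $\infty$, i.e. $\phi(z)\to\infty$ and $\phi(z)/z\to1$ as $z\to\infty$ non-tangentially (that is, as $|z|\to\infty$ inside each sector $\{|\operatorname{Arg} z-\pi/2|<\theta_0\}$, $0<\theta_0<\pi/2$). Suppose that $\phi$ is of type I (non-zero step): writing $\phi_n$ for the $n$-th iterate of $\phi$ and $z_n=\phi_n(i)$, the steps $d(z_n,z_{n+1})$ tend to a limit $s_\infty>0$. Let $\{w_n\}_{n\ge0}\subset\mathbb H$ be a backward-iteration sequence with bounded steps (BISBS) for $\phi$, i.e. $\phi(w_{n+1})=w_n$ for all $n\ge0$, and there is a constant $a<1$ with $d(w_n,w_{n+1})\le a$ for all $n\ge 0$. Suppose that $w_n\to\infty$. Then $\{w_n\}$ has non-zero height: the sequence $\operatorname{Im} w_n$ is non-increasing and converges to a limit $\ell_\infty>0$. -/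

import Mathlib

open Filter Topology

/-- The open upper half-plane, as a subset of `ℂ`. -/
def upperHalf : Set ℂ := {z : ℂ | 0 < z.im}

/-- The pseudo-hyperbolic distance of the upper half-plane,
`d(z,w) = |(w - z) / (w - conj z)|`. For `z, w` in the upper half-plane the
denominator does not vanish. -/
noncomputable def pseudoHypDist (z w : ℂ) : ℝ :=
  ‖(w - z) / (w - (starRingEnd ℂ) z)‖

/-- The sector `{z : |Arg z - π/2| < θ}`. For `0 < θ < π/2` these are the non-tangential
approach regions for `∞` in the upper half-plane. -/
def sectorAtInfty (θ : ℝ) : Set ℂ := {z : ℂ | |z.arg - Real.pi / 2| < θ}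

/-- `f z` tends to `l` as `z → ∞` non-tangentially in the upper half-plane, i.e. as `|z| → ∞`
inside every sector `|Arg z - π/2| < θ` with `0 < θ < π/2`. (`Bornology.cobounded ℂ` is the
filter of neighbourhoods of the point `∞` of the Riemann sphere.) -/
def TendstoNontangentially (f : ℂ → ℂ) (l : Filter ℂ) : Prop :=
  ∀ θ : ℝ, 0 < θ → θ < Real.pi / 2 →
    Tendsto f (Bornology.cobounded ℂ ⊓ 𝓟 (sectorAtInfty θ)) l

/-- `φ` restricts to an analytic self-map of the upper half-plane, parabolic with Denjoy-Wolff
point `∞`: `φ z → ∞` and `φ z / z → 1` as `z → ∞` non-tangentially. -/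
structure IsParabolicSelfMap (φ : ℂ → ℂ) : Prop where
  analytic : DifferentiableOn ℂ φ upperHalf
  mapsTo : Set.MapsTo φ upperHalf upperHalf
  tendsto_infty : TendstoNontangentially φ (Bornology.cobounded ℂ)
  tendsto_div : TendstoNontangentially (fun z => φ z / z) (𝓝 1)

/-- Type I (non-zero step): for the forward orbit `z_n = φ^n(i)`, the steps `d(z_n, z_{n+1})`
tend to a limit `s_∞ > 0`. -/
def IsTypeI (φ : ℂ → ℂ) : Prop :=
  ∃ s : ℝ, 0 < s ∧
    Tendsto (fun n : ℕ => pseudoHypDist (φ^[n] Complex.I) (φ^[n + 1] Complex.I)) atTop (𝓝 s)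

/-- `w` is a backward-iteration sequence with bounded steps for the self-map `φ` of the upper
half-plane. -/
structure IsBISBS (φ : ℂ → ℂ) (w : ℕ → ℂ) : Prop where
  mem : ∀ n, w n ∈ upperHalf
  map_succ : ∀ n, φ (w (n + 1)) = w n
  bounded_steps : ∃ a : ℝ, a < 1 ∧ ∀ n, pseudoHypDist (w n) (w (n + 1)) ≤ a

/-!
By Julia's lemma `φ` does not lower heights, so Schwarz–Pick applies both to `φ` and to its
displacement `φ z - z`. Together they show that the displacement measured in units of the height,
`(φ z - z) / Im z`, changes along a forward orbit by an amount controlled by the loss of hyperbolic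
step. Since the losses add up to a finite total, the orbit looks asymptotically like that of an
automorphism fixing `∞`; with non-zero step this gives `|z_n - z_0|² ≥ c n² Im z_n Im z_0` up to an
additive multiple of `Im z_n Im z_0`.

Pulled back along a backward orbit, `r_n = |w_n - conj w_0|` satisfies `c n² Im w_n ≤ r_n²`. As the
steps are bounded, `|w_{n+1} - w_n|` is at most a multiple of `√(Im w_n Im w_{n+1})`, hence of
`r_n r_{n+1} / (n (n + 1))`, so `1 / r_n - B / n` is non-decreasing for a suitable `B`; it tends to
`0`, which means `n ≤ B r_n`. On the other hand `r_n` is at most a constant plus a multiple of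
`∑ Im w_k`, so the average of the heights stays away from `0`, and so does their limit.
-/

open scoped ComplexConjugate

/-- The point-pair invariant `|w - z|² / (Im z Im w)` of the upper half-plane, an increasing
function of the hyperbolic distance: it is `2 (cosh d - 1)` for the metric of `UpperHalfPlane`.
It measures the steps of an orbit here because it is algebraic in the displacement of the map. -/
noncomputable def pairInvariant (z w : ℂ) : ℝ := ‖w - z‖ ^ 2 / (z.im * w.im)

lemma I_mem_upperHalf : Complex.I ∈ upperHalf := by simp [upperHalf]

section PairInvariant

variable {z w : ℂ}

lemma pairInvariant_nonneg (hz : z ∈ upperHalf) (hw : w ∈ upperHalf) : 0 ≤ pairInvariant z w :=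
  div_nonneg (sq_nonneg _) (mul_pos hz hw).le

lemma pairInvariant_comm (z w : ℂ) : pairInvariant z w = pairInvariant w z := by
  rw [pairInvariant, pairInvariant, norm_sub_rev, mul_comm z.im]

lemma pairInvariant_mul_im_mul_im (hz : z ∈ upperHalf) (hw : w ∈ upperHalf) :
    pairInvariant z w * (z.im * w.im) = ‖w - z‖ ^ 2 :=
  div_mul_cancel₀ _ (mul_pos hz hw).ne'

lemma norm_sub_conj_sq (z w : ℂ) : ‖w - conj z‖ ^ 2 = ‖w - z‖ ^ 2 + 4 * (z.im * w.im) := by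
  simp only [Complex.sq_norm, Complex.normSq_apply, Complex.sub_re, Complex.sub_im,
    Complex.conj_re, Complex.conj_im]
  ring

lemma sub_conj_ne_zero (hz : z ∈ upperHalf) (hw : w ∈ upperHalf) : w - conj z ≠ 0 := fun h => by
  have him : w.im + z.im = 0 := by simpa using congrArg Complex.im h
  exact (add_pos hw hz).ne' him

lemma pseudoHypDist_sq (hz : z ∈ upperHalf) (hw : w ∈ upperHalf) :
    pseudoHypDist z w ^ 2 = pairInvariant z w / (pairInvariant z w + 4) := by
  have hz' : 0 < z.im := hz
  have hw' : 0 < w.im := hw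
  rw [pseudoHypDist, pairInvariant, norm_div, div_pow, norm_sub_conj_sq]
  field_simp

lemma pseudoHypDist_lt_one (hz : z ∈ upperHalf) (hw : w ∈ upperHalf) : pseudoHypDist z w < 1 := by
  have hu := pairInvariant_nonneg hz hw
  rw [← sq_lt_one_iff₀ (show 0 ≤ pseudoHypDist z w from norm_nonneg _),
    pseudoHypDist_sq hz hw, div_lt_one (by linarith)]
  linarith

lemma four_mul_pseudoHypDist_sq_le (hz : z ∈ upperHalf) (hw : w ∈ upperHalf) :
    4 * pseudoHypDist z w ^ 2 ≤ pairInvariant z w := by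
  have hu := pairInvariant_nonneg hz hw
  rw [pseudoHypDist_sq hz hw, ← mul_div_assoc, div_le_iff₀ (by linarith)]
  nlinarith

lemma pairInvariant_le_of_pseudoHypDist_le (hz : z ∈ upperHalf) (hw : w ∈ upperHalf) {a : ℝ}
    (ha : a < 1) (h : pseudoHypDist z w ≤ a) : pairInvariant z w ≤ 4 * a ^ 2 / (1 - a ^ 2) := by
  have hu := pairInvariant_nonneg hz hw
  have ha0 : 0 ≤ a := (norm_nonneg _).trans h
  have hsq : pseudoHypDist z w ^ 2 ≤ a ^ 2 := pow_le_pow_left₀ (norm_nonneg _) h 2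
  rw [pseudoHypDist_sq hz hw, div_le_iff₀ (by linarith)] at hsq
  rw [le_div_iff₀ (by nlinarith)]
  linarith

lemma pairInvariant_le_pairInvariant {z' w' : ℂ} (hz : z ∈ upperHalf) (hw : w ∈ upperHalf)
    (hz' : z' ∈ upperHalf) (hw' : w' ∈ upperHalf) (h : pseudoHypDist z w ≤ pseudoHypDist z' w') :
    pairInvariant z w ≤ pairInvariant z' w' := by
  have hu := pairInvariant_nonneg hz hw
  have hu' := pairInvariant_nonneg hz' hw'
  have hsq : pseudoHypDist z w ^ 2 ≤ pseudoHypDist z' w' ^ 2 :=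
    pow_le_pow_left₀ (norm_nonneg _) h 2
  rw [pseudoHypDist_sq hz hw, pseudoHypDist_sq hz' hw',
    div_le_div_iff₀ (by linarith) (by linarith)] at hsq
  linarith

lemma pairInvariant_coe_add_two (z w : UpperHalfPlane) :
    pairInvariant z w + 2 = 2 * Real.cosh (dist z w) := by
  rw [UpperHalfPlane.cosh_dist, Complex.dist_eq, norm_sub_rev, pairInvariant,
    UpperHalfPlane.coe_im, UpperHalfPlane.coe_im]
  field_simp
  ring

-- The triangle inequality, through `cosh (s + t) ≤ 2 cosh s cosh t`.
lemma pairInvariant_add_two_le_mul {v : ℂ} (hz : z ∈ upperHalf) (hv : v ∈ upperHalf)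
    (hw : w ∈ upperHalf) :
    pairInvariant z w + 2 ≤ (pairInvariant z v + 2) * (pairInvariant v w + 2) := by
  lift z to UpperHalfPlane using hz
  lift v to UpperHalfPlane using hv
  lift w to UpperHalfPlane using hw
  simp only [pairInvariant_coe_add_two]
  have hcosh : Real.cosh (dist z w) ≤ Real.cosh (dist z v + dist v w) := by
    rw [Real.cosh_le_cosh, abs_of_nonneg dist_nonneg, abs_of_nonneg (by positivity)]
    exact dist_triangle z v w
  rw [Real.cosh_add] at hcosh
  have hsinh : Real.sinh (dist z v) * Real.sinh (dist v w) ≤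
      Real.cosh (dist z v) * Real.cosh (dist v w) :=
    mul_le_mul (Real.sinh_lt_cosh _).le (Real.sinh_lt_cosh _).le
      (Real.sinh_nonneg_iff.mpr dist_nonneg) (Real.cosh_pos _).le
  linarith

end PairInvariant

section SchwarzPick

variable {f : ℂ → ℂ} {z w : ℂ}

/-- The Cayley transform of the upper half-plane onto the unit disc that sends `z` to `0`.
Conjugation by it reduces Schwarz–Pick to the Schwarz lemma. -/
noncomputable def cayley (z w : ℂ) : ℂ := (w - z) / (w - conj z)

/-- The inverse of the Cayley transform `cayley z`. -/
noncomputable def cayleySymm (z ζ : ℂ) : ℂ := (z - conj z * ζ) / (1 - ζ)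

lemma one_sub_ne_zero_of_mem_ball {ζ : ℂ} (hζ : ζ ∈ Metric.ball (0 : ℂ) 1) : 1 - ζ ≠ 0 := by
  rintro h
  simp [← sub_eq_zero.mp h] at hζ

lemma mapsTo_cayley (hz : z ∈ upperHalf) :
    Set.MapsTo (cayley z) upperHalf (Metric.ball 0 1) := fun _ hw =>
  mem_ball_zero_iff.mpr (pseudoHypDist_lt_one hz hw)

lemma differentiableOn_cayley (hz : z ∈ upperHalf) : DifferentiableOn ℂ (cayley z) upperHalf :=
  (differentiableOn_id.sub_const _).div (differentiableOn_id.sub_const _)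
    fun _ hw => sub_conj_ne_zero hz hw

lemma mapsTo_cayleySymm (hz : z ∈ upperHalf) :
    Set.MapsTo (cayleySymm z) (Metric.ball 0 1) upperHalf := fun ζ hζ => by
  have hne := one_sub_ne_zero_of_mem_ball hζ
  have him : (cayleySymm z ζ).im = z.im * (1 - ‖ζ‖ ^ 2) / Complex.normSq (1 - ζ) := by
    simp only [cayleySymm, Complex.div_im, Complex.sq_norm, Complex.normSq_apply, Complex.sub_re,
      Complex.sub_im, Complex.mul_re, Complex.mul_im, Complex.conj_re, Complex.conj_im,
      Complex.one_re, Complex.one_im]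
    ring
  have hlt : ‖ζ‖ ^ 2 < 1 := (sq_lt_one_iff₀ (norm_nonneg _)).mpr (mem_ball_zero_iff.mp hζ)
  change 0 < (cayleySymm z ζ).im
  rw [him]
  exact div_pos (mul_pos hz (sub_pos.mpr hlt)) (Complex.normSq_pos.mpr hne)

lemma differentiableOn_cayleySymm (z : ℂ) :
    DifferentiableOn ℂ (cayleySymm z) (Metric.ball 0 1) :=
  DifferentiableOn.div (by fun_prop) (by fun_prop) fun _ => one_sub_ne_zero_of_mem_ball

lemma cayleySymm_cayley (hz : z ∈ upperHalf) (hw : w ∈ upperHalf) :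
    cayleySymm z (cayley z w) = w := by
  have hwz := sub_conj_ne_zero hz hw
  have hne := one_sub_ne_zero_of_mem_ball (mapsTo_cayley hz hw)
  rw [cayleySymm, div_eq_iff hne, cayley]
  field_simp
  ring

lemma pseudoHypDist_map_le (hf : DifferentiableOn ℂ f upperHalf)
    (hm : Set.MapsTo f upperHalf upperHalf) (hz : z ∈ upperHalf) (hw : w ∈ upperHalf) :
    pseudoHypDist (f z) (f w) ≤ pseudoHypDist z w := by
  have hd : DifferentiableOn ℂ (cayley (f z) ∘ f ∘ cayleySymm z) (Metric.ball 0 1) :=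
    (differentiableOn_cayley (hm hz)).comp
      (hf.comp (differentiableOn_cayleySymm z) (mapsTo_cayleySymm hz))
      (hm.comp (mapsTo_cayleySymm hz))
  have hmaps : Set.MapsTo (cayley (f z) ∘ f ∘ cayleySymm z) (Metric.ball 0 1)
      (Metric.closedBall 0 1) :=
    ((mapsTo_cayley (hm hz)).comp (hm.comp (mapsTo_cayleySymm hz))).mono_right
      Metric.ball_subset_closedBall
  have hschwarz := Complex.norm_le_norm_of_mapsTo_ball hd hmaps (by simp [cayley, cayleySymm])
    (pseudoHypDist_lt_one hz hw)
  change ‖cayley (f z) (f (cayleySymm z (cayley z w)))‖ ≤ _ at hschwarz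
  rwa [cayleySymm_cayley hz hw] at hschwarz

lemma pairInvariant_map_le (hf : DifferentiableOn ℂ f upperHalf)
    (hm : Set.MapsTo f upperHalf upperHalf) (hz : z ∈ upperHalf) (hw : w ∈ upperHalf) :
    pairInvariant (f z) (f w) ≤ pairInvariant z w :=
  pairInvariant_le_pairInvariant (hm hz) (hm hw) hz hw (pseudoHypDist_map_le hf hm hz hw)

-- For maps into the closed half-plane, where `pairInvariant (f z) (f w)` may be a junk value.
lemma norm_map_sub_sq_le (hf : DifferentiableOn ℂ f upperHalf)
    (hm : ∀ v ∈ upperHalf, 0 ≤ (f v).im) (hz : z ∈ upperHalf) (hw : w ∈ upperHalf) :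
    ‖f w - f z‖ ^ 2 ≤ pairInvariant z w * ((f z).im * (f w).im) := by
  have hperturbed : ∀ ε : ℝ, 0 < ε →
      ‖f w - f z‖ ^ 2 ≤ pairInvariant z w * (((f z).im + ε) * ((f w).im + ε)) := fun ε hε => by
    have hmε : Set.MapsTo (fun v => f v + ε * Complex.I) upperHalf upperHalf := fun v hv => by
      simpa [upperHalf] using add_pos_of_nonneg_of_pos (hm v hv) hε
    have h := pairInvariant_map_le (hf.add_const _) hmε hz hw
    rw [pairInvariant, div_le_iff₀ (mul_pos (hmε hz) (hmε hw))] at h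
    simpa using h
  have hlim : Tendsto (fun ε : ℝ => pairInvariant z w * (((f z).im + ε) * ((f w).im + ε)))
      (𝓝[>] 0) (𝓝 (pairInvariant z w * (((f z).im + 0) * ((f w).im + 0)))) :=
    (Continuous.tendsto (by fun_prop) 0).mono_left nhdsWithin_le_nhds
  simp only [add_zero] at hlim
  exact ge_of_tendsto hlim (eventually_nhdsWithin_of_forall hperturbed)

end SchwarzPick

section Julia

variable {f : ℂ → ℂ} {z : ℂ}

-- Julia's lemma at `∞`: let `t → ∞` in the rescaled Schwarz–Pick inequality for `z` and `t i`.
lemma mul_im_le_im_map (hf : DifferentiableOn ℂ f upperHalf)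
    (hm : Set.MapsTo f upperHalf upperHalf) {c : ℝ} (hc : 0 < c)
    (hlim : Tendsto (fun t : ℝ => f (t * Complex.I) / t) atTop (𝓝 (c * Complex.I)))
    (hz : z ∈ upperHalf) : c * z.im ≤ (f z).im := by
  have hdiv : ∀ v : ℂ, Tendsto (fun t : ℝ => v / (t : ℂ)) atTop (𝓝 0) := fun v =>
    squeeze_zero_norm (fun t => (norm_div v t).le) <| by
      simpa using tendsto_const_nhds.div_atTop tendsto_abs_atTop_atTop
  have hle : ∀ᶠ t : ℝ in atTop, ‖f (t * Complex.I) / t - f z / t‖ ^ 2 * z.im ≤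
      ‖Complex.I - z / t‖ ^ 2 * ((f z).im * (f (t * Complex.I) / t).im) := by
    filter_upwards [eventually_gt_atTop 0] with t ht
    have htI : (t : ℂ) * Complex.I ∈ upperHalf := by simpa [upperHalf] using ht
    have htc : (t : ℂ) ≠ 0 := Complex.ofReal_ne_zero.mpr ht.ne'
    have hSP := mul_le_mul_of_nonneg_right
      (norm_map_sub_sq_le hf (fun v hv => (hm hv).le) hz htI) (mul_pos hz htI).le
    rw [mul_right_comm, pairInvariant_mul_im_mul_im hz htI, Complex.im_ofReal_mul, Complex.I_im,
      mul_one] at hSP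
    rw [← sub_div, ← mul_div_cancel_left₀ Complex.I htc, ← sub_div, Complex.div_ofReal_im, norm_div,
      norm_div, Complex.norm_real, Real.norm_of_nonneg ht.le, mul_div_cancel_left₀ _ htc]
    field_simp
    linarith
  have hL := (((hlim.sub (hdiv (f z))).norm).pow 2).mul_const z.im
  have hR := (((tendsto_const_nhds (x := Complex.I).sub (hdiv z)).norm).pow 2).mul
    (((Complex.continuous_im.tendsto _).comp hlim).const_mul (f z).im)
  have hlimits : c ^ 2 * z.im ≤ (f z).im * c := by
    simpa [abs_of_pos hc] using le_of_tendsto_of_tendsto hL hR hle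
  refine le_of_mul_le_mul_left ?_ hc
  linarith

lemma tendsto_ofReal_mul_I_nontangential {θ : ℝ} (hθ : 0 < θ) :
    Tendsto (fun t : ℝ => (t : ℂ) * Complex.I) atTop
      (Bornology.cobounded ℂ ⊓ 𝓟 (sectorAtInfty θ)) := by
  refine tendsto_inf.mpr ⟨?_, tendsto_principal.mpr ?_⟩
  · rw [← tendsto_norm_atTop_iff_cobounded]
    simpa using tendsto_abs_atTop_atTop
  · filter_upwards [eventually_gt_atTop 0] with t ht
    simpa [sectorAtInfty, Complex.arg_real_mul _ ht] using hθ

lemma IsParabolicSelfMap.tendsto_map_mul_I_div {φ : ℂ → ℂ} (hφ : IsParabolicSelfMap φ) :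
    Tendsto (fun t : ℝ => φ (t * Complex.I) / t) atTop (𝓝 Complex.I) := by
  have hray := ((hφ.tendsto_div (Real.pi / 4) (by positivity) (by linarith [Real.pi_pos])).comp
    (tendsto_ofReal_mul_I_nontangential (by positivity))).mul_const Complex.I
  rw [one_mul] at hray
  refine hray.congr fun t => ?_
  rw [Function.comp_apply, div_mul_eq_mul_div, mul_div_mul_right _ _ Complex.I_ne_zero]

end Julia

/-- Holomorphic self-maps of the upper half-plane that do not lower heights. By Julia's lemma these
are the identity and the maps with Denjoy–Wolff point `∞`, parabolic or hyperbolic; equivalently,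
the displacement `φ z - z` is holomorphic with values in the closed half-plane. -/
structure IsHeightRaising (φ : ℂ → ℂ) : Prop where
  differentiableOn : DifferentiableOn ℂ φ upperHalf
  im_le : ∀ z ∈ upperHalf, z.im ≤ (φ z).im

lemma IsParabolicSelfMap.isHeightRaising {φ : ℂ → ℂ} (hφ : IsParabolicSelfMap φ) :
    IsHeightRaising φ where
  differentiableOn := hφ.analytic
  im_le z hz := by
    simpa using mul_im_le_im_map hφ.analytic hφ.mapsTo one_pos
      (by simpa using hφ.tendsto_map_mul_I_div) hz

/-- The displacement of `φ` at `z` in units of the height of `z`, which is constant along the orbits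
of the automorphisms fixing `∞`. -/
noncomputable def normStep (φ : ℂ → ℂ) (z : ℂ) : ℂ := (φ z - z) / (z.im : ℂ)

section NormStep

variable {φ : ℂ → ℂ} {z : ℂ}

lemma im_mul_normStep (hz : z ∈ upperHalf) : z.im * normStep φ z = φ z - z :=
  mul_div_cancel₀ _ (Complex.ofReal_ne_zero.mpr (ne_of_gt hz))

lemma im_mul_one_add_im_normStep (hz : z ∈ upperHalf) :
    z.im * (1 + (normStep φ z).im) = (φ z).im := by
  have h := congrArg Complex.im (im_mul_normStep (φ := φ) hz)
  rw [Complex.im_ofReal_mul, Complex.sub_im] at h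
  linarith

lemma pairInvariant_map_self (hz : z ∈ upperHalf) :
    pairInvariant z (φ z) = ‖normStep φ z‖ ^ 2 / (1 + (normStep φ z).im) := by
  have hz' : 0 < z.im := hz
  rw [pairInvariant, ← im_mul_one_add_im_normStep hz, ← im_mul_normStep hz, norm_mul,
    Complex.norm_of_nonneg hz'.le]
  field_simp

end NormStep

section InnerProductSpace

variable {E : Type*} [NormedAddCommGroup E] [InnerProductSpace ℝ E]

-- For consecutive normalized displacements `q`, `q'` of an orbit whose height is multiplied by `κ`,
-- then by `lam`, the hypothesis is Schwarz–Pick for the displacement, and the last factor of the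
-- conclusion is the decrease of `pairInvariant`.
lemma norm_sub_sq_le_of_norm_smul_sub_sq_le {q q' : E} {κ lam : ℝ} (hκ : 0 < κ) (hlam : lam ≠ 0)
    (h : ‖κ • q' - q‖ ^ 2 ≤ (κ - 1) * (lam - 1) * ‖q‖ ^ 2) :
    ‖q' - q‖ ^ 2 ≤ (κ - 1) * lam * (‖q‖ ^ 2 / κ - ‖q'‖ ^ 2 / lam) := by
  have hpolar : κ * ‖q' - q‖ ^ 2 =
      (κ - 1) * (‖q‖ ^ 2 - κ * ‖q'‖ ^ 2) + ‖κ • q' - q‖ ^ 2 := by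
    rw [norm_sub_sq_real, norm_sub_sq_real, norm_smul, inner_smul_left, mul_pow, Real.norm_eq_abs,
      sq_abs, conj_trivial]
    ring
  refine le_of_mul_le_mul_left ?_ hκ
  calc κ * ‖q' - q‖ ^ 2
      ≤ (κ - 1) * (‖q‖ ^ 2 - κ * ‖q'‖ ^ 2) + (κ - 1) * (lam - 1) * ‖q‖ ^ 2 := by linarith
    _ = κ * ((κ - 1) * lam * (‖q‖ ^ 2 / κ - ‖q'‖ ^ 2 / lam)) := by field_simp; ring

end InnerProductSpace

lemma sq_mul_pow_le_mul_geom_sum_sq {κ : ℝ} (hκ : 0 ≤ κ) (n : ℕ) :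
    (n : ℝ) ^ 2 * κ ^ n ≤ κ * (∑ i ∈ Finset.range n, κ ^ i) ^ 2 := by
  obtain _ | n := n
  · simp
  have hcauchy := Finset.sum_sq_le_sum_mul_sum_of_sq_le_mul (Finset.range (n + 1))
    (r := fun _ => √(κ ^ n)) (f := fun i => κ ^ i) (g := fun i => κ ^ (n - i))
    (fun _ _ => by positivity) (fun _ _ => by positivity) fun i hi => by
      rw [Real.sq_sqrt (by positivity), ← pow_add,
        Nat.add_sub_of_le (Nat.lt_succ_iff.mp (Finset.mem_range.mp hi))]
  have hreflect : ∑ i ∈ Finset.range (n + 1), κ ^ (n - i) = ∑ i ∈ Finset.range (n + 1), κ ^ i := by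
    simpa using Finset.sum_range_reflect (fun i => κ ^ i) (n + 1)
  rw [hreflect, ← sq, Finset.sum_const, Finset.card_range, nsmul_eq_mul, mul_pow,
    Real.sq_sqrt (by positivity)] at hcauchy
  calc ((n + 1 : ℕ) : ℝ) ^ 2 * κ ^ (n + 1) = κ * (((n + 1 : ℕ) : ℝ) ^ 2 * κ ^ n) := by ring
    _ ≤ _ := mul_le_mul_of_nonneg_left hcauchy hκ

lemma tendsto_add_of_tendsto_succ_sub {E : Type*} [AddCommGroup E] [TopologicalSpace E]
    [ContinuousAdd E] {x : ℕ → E} {a : E} {l : Filter ℕ} (hl : l ≤ atTop)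
    (hsucc : Tendsto (fun m => x (m + 1) - x m) atTop (𝓝 0)) (hx : Tendsto x l (𝓝 a)) (j : ℕ) :
    Tendsto (fun m => x (m + j)) l (𝓝 a) := by
  induction j with
  | zero => exact hx
  | succ j ih =>
    have hj := (hsucc.comp (tendsto_add_atTop_nat j)).mono_left hl
    simpa [add_assoc] using ih.add hj

namespace IsHeightRaising

variable {φ : ℂ → ℂ} {z w : ℂ}

lemma mapsTo (hφ : IsHeightRaising φ) : Set.MapsTo φ upperHalf upperHalf :=
  fun z hz => lt_of_lt_of_le hz (hφ.im_le z hz)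

lemma iterate_mem (hφ : IsHeightRaising φ) (hz : z ∈ upperHalf) (n : ℕ) : φ^[n] z ∈ upperHalf :=
  hφ.mapsTo.iterate n hz

lemma pairInvariant_iterate_le (hφ : IsHeightRaising φ) (hz : z ∈ upperHalf) (hw : w ∈ upperHalf)
    (n : ℕ) : pairInvariant (φ^[n] z) (φ^[n] w) ≤ pairInvariant z w := by
  induction n with
  | zero => exact le_rfl
  | succ n ih =>
    rw [Function.iterate_succ_apply', Function.iterate_succ_apply']
    exact (pairInvariant_map_le hφ.differentiableOn hφ.mapsTo (hφ.iterate_mem hz n)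
      (hφ.iterate_mem hw n)).trans ih

lemma norm_displacement_sub_sq_le (hφ : IsHeightRaising φ) (hz : z ∈ upperHalf)
    (hw : w ∈ upperHalf) :
    ‖(φ w - w) - (φ z - z)‖ ^ 2 ≤ pairInvariant z w * ((φ z - z).im * (φ w - w).im) :=
  norm_map_sub_sq_le (f := fun v => φ v - v) (hφ.differentiableOn.sub differentiableOn_id)
    (fun v hv => by simpa using hφ.im_le v hv) hz hw

lemma im_normStep_nonneg (hφ : IsHeightRaising φ) (hz : z ∈ upperHalf) :
    0 ≤ (normStep φ z).im := by
  rw [normStep, Complex.div_ofReal_im, Complex.sub_im]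
  exact div_nonneg (sub_nonneg.mpr (hφ.im_le z hz)) (le_of_lt hz)

lemma norm_normStep_le (hφ : IsHeightRaising φ) (hz : z ∈ upperHalf) :
    ‖normStep φ z‖ ≤ 1 + pairInvariant z (φ z) := by
  have him := hφ.im_normStep_nonneg hz
  have hu := pairInvariant_nonneg hz (hφ.mapsTo hz)
  have hsq : ‖normStep φ z‖ ^ 2 = pairInvariant z (φ z) * (1 + (normStep φ z).im) := by
    rw [pairInvariant_map_self hz, div_mul_cancel₀ _ (by positivity)]
  have himle : (normStep φ z).im ≤ ‖normStep φ z‖ := Complex.im_le_norm _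
  by_contra! hlt
  nlinarith

lemma norm_normStep_map_sub_sq_le (hφ : IsHeightRaising φ) (hz : z ∈ upperHalf) :
    ‖normStep φ (φ z) - normStep φ z‖ ^ 2 ≤
      (normStep φ z).im * (1 + (normStep φ (φ z)).im) *
        (pairInvariant z (φ z) - pairInvariant (φ z) (φ (φ z))) := by
  have hz' : 0 < z.im := hz
  have hz1 := hφ.mapsTo hz
  have hq := hφ.im_normStep_nonneg hz
  have hq' := hφ.im_normStep_nonneg hz1
  have hheight := im_mul_one_add_im_normStep (φ := φ) hz
  have hSP := hφ.norm_displacement_sub_sq_le hz hz1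
  rw [pairInvariant_map_self hz, ← im_mul_normStep hz1, ← im_mul_normStep hz, ← hheight] at hSP
  rw [pairInvariant_map_self hz, pairInvariant_map_self hz1]
  set q := normStep φ z
  set q' := normStep φ (φ z)
  have hscaled : ‖(1 + q.im) • q' - q‖ ^ 2 ≤ (1 + q.im - 1) * (1 + q'.im - 1) * ‖q‖ ^ 2 := by
    have hfactor : ((z.im * (1 + q.im) : ℝ) : ℂ) * q' - z.im * q =
        z.im * ((1 + q.im) • q' - q) := by
      rw [Complex.real_smul]
      push_cast
      ring
    rw [hfactor, norm_mul, Complex.norm_of_nonneg hz'.le, Complex.im_ofReal_mul,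
      Complex.im_ofReal_mul] at hSP
    refine le_of_mul_le_mul_left ?_ (pow_pos hz' 2)
    calc z.im ^ 2 * ‖(1 + q.im) • q' - q‖ ^ 2 = (z.im * ‖(1 + q.im) • q' - q‖) ^ 2 := by ring
      _ ≤ _ := hSP
      _ = z.im ^ 2 * ((1 + q.im - 1) * (1 + q'.im - 1) * ‖q‖ ^ 2) := by
        field_simp
        ring
  simpa using norm_sub_sq_le_of_norm_smul_sub_sq_le (by positivity) (by positivity) hscaled

section Orbit

lemma antitone_pairInvariant_iterate_add (hφ : IsHeightRaising φ) (hz : z ∈ upperHalf) (n : ℕ) :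
    Antitone fun m => pairInvariant (φ^[m] z) (φ^[m + n] z) :=
  antitone_nat_of_succ_le fun m => by
    simpa only [Nat.add_right_comm m 1 n, Function.iterate_succ_apply'] using
      pairInvariant_map_le hφ.differentiableOn hφ.mapsTo (hφ.iterate_mem hz m)
        (hφ.iterate_mem hz (m + n))

lemma tendsto_pairInvariant_iterate_sub (hφ : IsHeightRaising φ) (hz : z ∈ upperHalf) :
    Tendsto (fun m => pairInvariant (φ^[m] z) (φ^[m + 1] z) -
      pairInvariant (φ^[m + 1] z) (φ^[m + 2] z)) atTop (𝓝 0) := by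
  have hbdd : BddBelow (Set.range fun m => pairInvariant (φ^[m] z) (φ^[m + 1] z)) :=
    ⟨0, Set.forall_mem_range.mpr fun m =>
      pairInvariant_nonneg (hφ.iterate_mem hz m) (hφ.iterate_mem hz (m + 1))⟩
  have hlim := tendsto_atTop_ciInf (hφ.antitone_pairInvariant_iterate_add hz 1) hbdd
  simpa using hlim.sub (hlim.comp (tendsto_add_atTop_nat 1))

lemma norm_normStep_iterate_le (hφ : IsHeightRaising φ) (hz : z ∈ upperHalf) (m : ℕ) :
    ‖normStep φ (φ^[m] z)‖ ≤ 1 + pairInvariant z (φ z) := by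
  refine (hφ.norm_normStep_le (hφ.iterate_mem hz m)).trans (add_le_add_right ?_ 1)
  rw [← Function.iterate_succ_apply' φ m z, Function.iterate_succ_apply φ m z]
  exact hφ.pairInvariant_iterate_le hz (hφ.mapsTo hz) m

lemma tendsto_normStep_iterate_succ_sub (hφ : IsHeightRaising φ) (hz : z ∈ upperHalf) :
    Tendsto (fun m => normStep φ (φ^[m + 1] z) - normStep φ (φ^[m] z)) atTop (𝓝 0) := by
  set M := 1 + pairInvariant z (φ z)
  have hbound : ∀ m, ‖normStep φ (φ^[m + 1] z) - normStep φ (φ^[m] z)‖ ^ 2 ≤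
      M * (1 + M) * (pairInvariant (φ^[m] z) (φ^[m + 1] z) -
        pairInvariant (φ^[m + 1] z) (φ^[m + 2] z)) := fun m => by
    have him : ∀ k, (normStep φ (φ^[k] z)).im ≤ M := fun k =>
      (Complex.im_le_norm _).trans (hφ.norm_normStep_iterate_le hz k)
    have h0 := hφ.im_normStep_nonneg (hφ.iterate_mem hz m)
    have h1 := hφ.im_normStep_nonneg (hφ.iterate_mem hz (m + 1))
    have hdefect := hφ.antitone_pairInvariant_iterate_add hz 1 m.le_succ
    have hstep := hφ.norm_normStep_map_sub_sq_le (hφ.iterate_mem hz m)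
    simp only [← Function.iterate_succ_apply'] at hstep
    exact hstep.trans (mul_le_mul_of_nonneg_right (mul_le_mul (him m)
      (add_le_add_right (him (m + 1)) 1) (by positivity) (h0.trans (him m)))
      (sub_nonneg.mpr hdefect))
  have hsq : Tendsto (fun m => ‖normStep φ (φ^[m + 1] z) - normStep φ (φ^[m] z)‖ ^ 2) atTop
      (𝓝 0) :=
    squeeze_zero (fun _ => sq_nonneg _) hbound
      (by simpa using (hφ.tendsto_pairInvariant_iterate_sub hz).const_mul (M * (1 + M)))
  rw [tendsto_zero_iff_norm_tendsto_zero]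
  simpa [Real.sqrt_sq] using hsq.sqrt

section AsymptoticStep

variable {l : Filter ℕ} {q : ℂ}

lemma tendsto_normStep_iterate_add (hφ : IsHeightRaising φ) (hz : z ∈ upperHalf) (hl : l ≤ atTop)
    (hq : Tendsto (fun m => normStep φ (φ^[m] z)) l (𝓝 q)) (j : ℕ) :
    Tendsto (fun m => normStep φ (φ^[m + j] z)) l (𝓝 q) :=
  tendsto_add_of_tendsto_succ_sub (x := fun m => normStep φ (φ^[m] z)) hl
    (hφ.tendsto_normStep_iterate_succ_sub hz) hq j

lemma tendsto_im_iterate_add_div (hφ : IsHeightRaising φ) (hz : z ∈ upperHalf) (hl : l ≤ atTop)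
    (hq : Tendsto (fun m => normStep φ (φ^[m] z)) l (𝓝 q)) (j : ℕ) :
    Tendsto (fun m => (φ^[m + j] z).im / (φ^[m] z).im) l (𝓝 ((1 + q.im) ^ j)) := by
  induction j with
  | zero =>
    simp only [add_zero, pow_zero]
    exact tendsto_const_nhds.congr fun m => (div_self (hφ.iterate_mem hz m).ne').symm
  | succ j ih =>
    have hstep := (Complex.continuous_im.tendsto q).comp
      (hφ.tendsto_normStep_iterate_add hz hl hq j)
    rw [pow_succ]
    refine (ih.mul (hstep.const_add 1)).congr fun m => ?_
    rw [← add_assoc, Function.iterate_succ_apply',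
      ← im_mul_one_add_im_normStep (hφ.iterate_mem hz (m + j)), div_mul_eq_mul_div,
      Function.comp_apply]

lemma tendsto_iterate_add_sub_div (hφ : IsHeightRaising φ) (hz : z ∈ upperHalf) (hl : l ≤ atTop)
    (hq : Tendsto (fun m => normStep φ (φ^[m] z)) l (𝓝 q)) (j : ℕ) :
    Tendsto (fun m => (φ^[m + j] z - φ^[m] z) / ((φ^[m] z).im : ℂ)) l
      (𝓝 ((∑ i ∈ Finset.range j, (1 + q.im) ^ i : ℝ) * q)) := by
  induction j with
  | zero => simpa using tendsto_const_nhds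
  | succ j ih =>
    have hratio := (Complex.continuous_ofReal.tendsto _).comp
      (hφ.tendsto_im_iterate_add_div hz hl hq j)
    have hstep := hφ.tendsto_normStep_iterate_add hz hl hq j
    rw [Finset.sum_range_succ, Complex.ofReal_add, add_mul]
    refine (ih.add (hratio.mul hstep)).congr fun m => ?_
    rw [Function.comp_apply, Complex.ofReal_div, div_mul_eq_mul_div,
      im_mul_normStep (hφ.iterate_mem hz (m + j)), ← add_div, ← add_assoc,
      Function.iterate_succ_apply']
    ring_nf

lemma tendsto_pairInvariant_iterate_add (hφ : IsHeightRaising φ) (hz : z ∈ upperHalf)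
    (hl : l ≤ atTop) (hq : Tendsto (fun m => normStep φ (φ^[m] z)) l (𝓝 q))
    (him : 0 ≤ q.im) (n : ℕ) :
    Tendsto (fun m => pairInvariant (φ^[m] z) (φ^[m + n] z)) l
      (𝓝 (((∑ i ∈ Finset.range n, (1 + q.im) ^ i) * ‖q‖) ^ 2 / (1 + q.im) ^ n)) := by
  have hnum := (hφ.tendsto_iterate_add_sub_div hz hl hq n).norm.pow 2
  rw [norm_mul, Complex.norm_of_nonneg (by positivity)] at hnum
  refine (hnum.div (hφ.tendsto_im_iterate_add_div hz hl hq n) (by positivity)).congr fun m => ?_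
  have hm : 0 < (φ^[m] z).im := hφ.iterate_mem hz m
  rw [Pi.div_apply, pairInvariant, norm_div, Complex.norm_of_nonneg hm.le]
  field_simp

end AsymptoticStep

-- Along an ultrafilter the rescaled orbit looks like that of an automorphism `v ↦ κ v + b`, for
-- which `n² u(v, φ v) ≤ u(v, φⁿ v)` by Cauchy–Schwarz.
lemma sq_mul_le_pairInvariant_iterate (hφ : IsHeightRaising φ) (hz : z ∈ upperHalf) {c : ℝ}
    (hc : ∀ m, c ≤ pairInvariant (φ^[m] z) (φ^[m + 1] z)) (n : ℕ) :
    (n : ℝ) ^ 2 * c ≤ pairInvariant z (φ^[n] z) := by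
  have hl : (hyperfilter ℕ : Filter ℕ) ≤ atTop := Nat.hyperfilter_le_atTop
  obtain ⟨q, -, hq : Tendsto (fun m => normStep φ (φ^[m] z)) (hyperfilter ℕ) (𝓝 q)⟩ :=
    (isCompact_closedBall (0 : ℂ) (1 + pairInvariant z (φ z))).ultrafilter_le_nhds
      ((hyperfilter ℕ).map fun m => normStep φ (φ^[m] z))
      (tendsto_principal.mpr <| .of_forall fun m =>
        mem_closedBall_zero_iff.mpr (hφ.norm_normStep_iterate_le hz m))
  have him : 0 ≤ q.im := ge_of_tendsto ((Complex.continuous_im.tendsto q).comp hq)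
    (.of_forall fun m => hφ.im_normStep_nonneg (hφ.iterate_mem hz m))
  have hstep := ge_of_tendsto (hφ.tendsto_pairInvariant_iterate_add hz hl hq him 1) (.of_forall hc)
  rw [Finset.sum_range_one, pow_zero, one_mul, pow_one, le_div_iff₀ (by positivity)] at hstep
  have hgeom := sq_mul_pow_le_mul_geom_sum_sq (κ := 1 + q.im) (by positivity) n
  set κ := 1 + q.im
  have hκ : 0 < κ := by positivity
  have hlimit : (n : ℝ) ^ 2 * c ≤ ((∑ i ∈ Finset.range n, κ ^ i) * ‖q‖) ^ 2 / κ ^ n := by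
    rw [le_div_iff₀ (by positivity)]
    refine le_of_mul_le_mul_left ?_ hκ
    calc κ * ((n : ℝ) ^ 2 * c * κ ^ n) = (n : ℝ) ^ 2 * κ ^ n * (c * κ) := by ring
      _ ≤ (n : ℝ) ^ 2 * κ ^ n * ‖q‖ ^ 2 := by gcongr
      _ ≤ κ * (∑ i ∈ Finset.range n, κ ^ i) ^ 2 * ‖q‖ ^ 2 := by gcongr
      _ = κ * ((∑ i ∈ Finset.range n, κ ^ i) * ‖q‖) ^ 2 := by ring
  refine hlimit.trans (le_of_tendsto (hφ.tendsto_pairInvariant_iterate_add hz hl hq him n)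
    (.of_forall fun m => ?_))
  simpa using hφ.antitone_pairInvariant_iterate_add hz n m.zero_le

end Orbit

lemma exists_sq_mul_le_pairInvariant_iterate_I (hφ : IsHeightRaising φ) (hI : IsTypeI φ) :
    ∃ c > 0, ∀ n : ℕ, (n : ℝ) ^ 2 * c ≤ pairInvariant Complex.I (φ^[n] Complex.I) := by
  obtain ⟨s, hs, hlim⟩ := hI
  have hmem := I_mem_upperHalf
  have hanti : Antitone fun n => pseudoHypDist (φ^[n] Complex.I) (φ^[n + 1] Complex.I) :=
    antitone_nat_of_succ_le fun n => by
      simpa only [Function.iterate_succ_apply'] using pseudoHypDist_map_le hφ.differentiableOn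
        hφ.mapsTo (hφ.iterate_mem hmem n) (hφ.iterate_mem hmem (n + 1))
  refine ⟨4 * s ^ 2, by positivity, hφ.sq_mul_le_pairInvariant_iterate hmem fun m => ?_⟩
  calc 4 * s ^ 2 ≤ 4 * pseudoHypDist (φ^[m] Complex.I) (φ^[m + 1] Complex.I) ^ 2 := by
        gcongr
        exact hanti.le_of_tendsto hlim m
    _ ≤ _ := four_mul_pseudoHypDist_sq_le (hφ.iterate_mem hmem m) (hφ.iterate_mem hmem (m + 1))

end IsHeightRaising

lemma natCast_le_mul_of_mul_succ_sub_le {r : ℕ → ℝ} {B : ℝ} (hr : ∀ n, 0 < r n)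
    (hinf : Tendsto r atTop atTop)
    (h : ∀ n : ℕ, n * (n + 1) * (r (n + 1) - r n) ≤ B * (r n * r (n + 1))) (n : ℕ) :
    n ≤ B * r n := by
  obtain rfl | hn := n.eq_zero_or_pos
  · have hB : 0 ≤ B := by
      refine nonneg_of_mul_nonneg_left ?_ (mul_pos (hr 0) (hr 1))
      simpa using h 0
    simpa using mul_nonneg hB (hr 0).le
  have hmono : Monotone fun k => (r (n + k))⁻¹ - B / (n + k : ℕ) := by
    refine monotone_nat_of_le_succ fun k => ?_
    have hrm := hr (n + k)
    have hrm' := hr (n + k + 1)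
    have hdiff : (r (n + k + 1))⁻¹ - B / ((n + k : ℕ) + 1) - ((r (n + k))⁻¹ - B / (n + k : ℕ)) =
        (B * (r (n + k) * r (n + k + 1)) -
          (n + k : ℕ) * ((n + k : ℕ) + 1) * (r (n + k + 1) - r (n + k))) /
        ((n + k : ℕ) * ((n + k : ℕ) + 1) * (r (n + k) * r (n + k + 1))) := by
      field_simp
      ring
    rw [← sub_nonneg, ← add_assoc, Nat.cast_succ, hdiff]
    exact div_nonneg (sub_nonneg.mpr (h (n + k))) (by positivity)
  have hshift : Tendsto (fun k => n + k) atTop atTop :=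
    tendsto_atTop_mono (fun k => Nat.le_add_left k n) tendsto_id
  have hlim : Tendsto (fun k => (r (n + k))⁻¹ - B / (n + k : ℕ)) atTop (𝓝 0) := by
    simpa using (hinf.inv_tendsto_atTop.comp hshift).sub
      ((tendsto_const_div_atTop_nhds_zero_nat B).comp hshift)
  have hzero : (r n)⁻¹ ≤ B / n := by simpa using hmono.ge_of_tendsto hlim 0
  rwa [inv_eq_one_div, div_le_div_iff₀ (hr n) (by positivity), one_mul] at hzero

namespace IsBISBS

variable {φ : ℂ → ℂ} {w : ℕ → ℂ}

lemma iterate_eq (hw : IsBISBS φ w) (n : ℕ) : φ^[n] (w n) = w 0 := by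
  induction n with
  | zero => rfl
  | succ n ih => rw [Function.iterate_succ_apply, hw.map_succ, ih]

lemma exists_norm_succ_sub_le (hw : IsBISBS φ w) :
    ∃ A ≥ 0, ∀ n, ‖w (n + 1) - w n‖ ≤ A * √((w n).im * (w (n + 1)).im) := by
  obtain ⟨a, ha, hstep⟩ := hw.bounded_steps
  refine ⟨√(4 * a ^ 2 / (1 - a ^ 2)), Real.sqrt_nonneg _, fun n => ?_⟩
  have him : 0 ≤ (w n).im * (w (n + 1)).im := (mul_pos (hw.mem n) (hw.mem (n + 1))).le
  rw [← Real.sqrt_mul' _ him]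
  refine Real.le_sqrt_of_sq_le ?_
  rw [← pairInvariant_mul_im_mul_im (hw.mem n) (hw.mem (n + 1))]
  exact mul_le_mul_of_nonneg_right
    (pairInvariant_le_of_pseudoHypDist_le (hw.mem n) (hw.mem (n + 1)) ha (hstep n)) him

lemma antitone_im (hw : IsBISBS φ w) (hφ : IsHeightRaising φ) : Antitone fun n => (w n).im :=
  antitone_nat_of_succ_le fun n => by
    simpa only [hw.map_succ] using hφ.im_le (w (n + 1)) (hw.mem (n + 1))

lemma exists_sq_mul_le_pairInvariant (hw : IsBISBS φ w) (hφ : IsHeightRaising φ)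
    (hI : IsTypeI φ) :
    ∃ c > 0, ∀ n : ℕ, (n : ℝ) ^ 2 * c ≤ pairInvariant (w 0) (w n) + 2 := by
  obtain ⟨c, hc, horbit⟩ := hφ.exists_sq_mul_le_pairInvariant_iterate_I hI
  have hmem := I_mem_upperHalf
  have hK : 0 < pairInvariant Complex.I (w 0) + 2 := by
    linarith [pairInvariant_nonneg hmem (hw.mem 0)]
  have hK' : 0 < pairInvariant (w 0) Complex.I + 2 := by
    linarith [pairInvariant_nonneg (hw.mem 0) hmem]
  set K := pairInvariant Complex.I (w 0) + 2
  set K' := pairInvariant (w 0) Complex.I + 2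
  refine ⟨c / (K * K'), by positivity, fun n => ?_⟩
  have hwn := hφ.iterate_mem (hw.mem 0) n
  have hIn := hφ.iterate_mem hmem n
  have hbase : pairInvariant (φ^[n] (w 0)) (φ^[n] Complex.I) + 2 ≤ K' :=
    add_le_add_left (hφ.pairInvariant_iterate_le (hw.mem 0) hmem n) 2
  have hpull : pairInvariant (w 0) (φ^[n] (w 0)) ≤ pairInvariant (w n) (w 0) := by
    simpa only [hw.iterate_eq] using hφ.pairInvariant_iterate_le (hw.mem n) (hw.mem 0) n
  rw [← mul_div_assoc, div_le_iff₀ (by positivity), pairInvariant_comm (w 0)]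
  calc (n : ℝ) ^ 2 * c ≤ pairInvariant Complex.I (φ^[n] Complex.I) + 2 := by linarith [horbit n]
    _ ≤ K * (pairInvariant (w 0) (φ^[n] Complex.I) + 2) :=
      pairInvariant_add_two_le_mul hmem (hw.mem 0) hIn
    _ ≤ K * ((pairInvariant (w 0) (φ^[n] (w 0)) + 2) *
          (pairInvariant (φ^[n] (w 0)) (φ^[n] Complex.I) + 2)) := by
      gcongr
      exact pairInvariant_add_two_le_mul (hw.mem 0) hwn hIn
    _ ≤ K * ((pairInvariant (w n) (w 0) + 2) * K') := by
      have hnonneg := pairInvariant_nonneg (hw.mem n) (hw.mem 0)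
      have hnonneg' := pairInvariant_nonneg hwn hIn
      gcongr
    _ = (pairInvariant (w n) (w 0) + 2) * (K * K') := by ring

lemma exists_sq_mul_im_le (hw : IsBISBS φ w) (hφ : IsHeightRaising φ) (hI : IsTypeI φ) :
    ∃ c > 0, ∀ n : ℕ, (n : ℝ) ^ 2 * (c * (w n).im) ≤ ‖w n - conj (w 0)‖ ^ 2 := by
  obtain ⟨c, hc, hgrowth⟩ := hw.exists_sq_mul_le_pairInvariant hφ hI
  have h0 : 0 < (w 0).im := hw.mem 0
  refine ⟨c * (w 0).im, by positivity, fun n => ?_⟩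
  have hn : 0 < (w n).im := hw.mem n
  rw [norm_sub_conj_sq, ← pairInvariant_mul_im_mul_im (hw.mem 0) (hw.mem n), ← add_mul]
  calc (n : ℝ) ^ 2 * (c * (w 0).im * (w n).im) = (n : ℝ) ^ 2 * c * ((w 0).im * (w n).im) := by ring
    _ ≤ (pairInvariant (w 0) (w n) + 4) * ((w 0).im * (w n).im) := by
      gcongr
      linarith [hgrowth n]

lemma exists_natCast_le_mul_norm (hw : IsBISBS φ w) (hφ : IsHeightRaising φ) (hI : IsTypeI φ)
    (hinf : Tendsto w atTop (Bornology.cobounded ℂ)) :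
    ∃ B ≥ 0, ∀ n : ℕ, n ≤ B * ‖w n - conj (w 0)‖ := by
  obtain ⟨A, hA, hstep⟩ := hw.exists_norm_succ_sub_le
  obtain ⟨c, hc, hheight⟩ := hw.exists_sq_mul_im_le hφ hI
  set r : ℕ → ℝ := fun n => ‖w n - conj (w 0)‖
  refine ⟨A / c, by positivity, natCast_le_mul_of_mul_succ_sub_le (r := r)
    (fun n => norm_pos_iff.mpr (sub_conj_ne_zero (hw.mem 0) (hw.mem n))) ?_ fun n => ?_⟩
  · exact tendsto_norm_cobounded_atTop.comp ((tendsto_sub_const_cobounded _).comp hinf)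
  have him : 0 < (w n).im := hw.mem n
  have him' : 0 < (w (n + 1)).im := hw.mem (n + 1)
  have hstep_r : r (n + 1) - r n ≤ A * √((w n).im * (w (n + 1)).im) := by
    refine (norm_sub_norm_le _ _).trans ?_
    simpa using hstep n
  have hgeom : n * (n + 1) * c * √((w n).im * (w (n + 1)).im) ≤ r n * r (n + 1) := by
    rw [← pow_le_pow_iff_left₀ (by positivity) (by positivity) two_ne_zero]
    calc (n * (n + 1) * c * √((w n).im * (w (n + 1)).im)) ^ 2
        = (n : ℝ) ^ 2 * (c * (w n).im) * (((n + 1 : ℕ) : ℝ) ^ 2 * (c * (w (n + 1)).im)) := by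
          rw [mul_pow, Real.sq_sqrt (by positivity)]
          push_cast
          ring
      _ ≤ r n ^ 2 * r (n + 1) ^ 2 :=
          mul_le_mul (hheight n) (hheight (n + 1)) (by positivity) (by positivity)
      _ = (r n * r (n + 1)) ^ 2 := by ring
  calc n * (n + 1) * (r (n + 1) - r n)
      ≤ n * (n + 1) * (A * √((w n).im * (w (n + 1)).im)) := by gcongr
    _ = A / c * (n * (n + 1) * c * √((w n).im * (w (n + 1)).im)) := by field_simp
    _ ≤ A / c * (r n * r (n + 1)) := by gcongr

lemma exists_norm_le_add_mul_sum_im (hw : IsBISBS φ w) (hφ : IsHeightRaising φ) (v : ℂ) :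
    ∃ A ≥ 0, ∀ n, ‖w n - v‖ ≤ ‖w 0 - v‖ + A * ∑ k ∈ Finset.range n, (w k).im := by
  obtain ⟨A, hA, hstep⟩ := hw.exists_norm_succ_sub_le
  have hstep_im : ∀ k, dist (w k) (w (k + 1)) ≤ A * (w k).im := fun k => by
    rw [dist_comm, dist_eq_norm]
    refine (hstep k).trans (mul_le_mul_of_nonneg_left (Real.sqrt_le_iff.mpr ?_) hA)
    have him : 0 < (w k).im := hw.mem k
    exact ⟨him.le, by nlinarith [hw.antitone_im hφ k.le_succ]⟩
  refine ⟨A, hA, fun n => ?_⟩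
  rw [Finset.mul_sum, ← dist_eq_norm, ← dist_eq_norm]
  calc dist (w n) v ≤ dist (w 0) v + dist (w 0) (w n) := by
        rw [add_comm, dist_comm (w 0)]
        exact dist_triangle _ _ _
    _ ≤ _ := by
        gcongr
        exact dist_le_range_sum_of_dist_le n fun _ => hstep_im _

lemma limit_im_pos (hw : IsBISBS φ w) (hφ : IsHeightRaising φ) (hI : IsTypeI φ)
    (hinf : Tendsto w atTop (Bornology.cobounded ℂ)) {l : ℝ}
    (hl : Tendsto (fun n => (w n).im) atTop (𝓝 l)) : 0 < l := by
  obtain ⟨B, hB, hlower⟩ := hw.exists_natCast_le_mul_norm hφ hI hinf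
  obtain ⟨A, hA, hupper⟩ := hw.exists_norm_le_add_mul_sum_im hφ (conj (w 0))
  set r₀ := ‖w 0 - conj (w 0)‖
  have hmean : ∀ᶠ n : ℕ in atTop,
      1 ≤ B * (r₀ / n + A * ((n : ℝ)⁻¹ * ∑ k ∈ Finset.range n, (w k).im)) := by
    filter_upwards [eventually_gt_atTop 0] with n hn
    have hn' : (0 : ℝ) < n := Nat.cast_pos.mpr hn
    calc (1 : ℝ) = (n : ℝ) / n := (div_self hn'.ne').symm
      _ ≤ B * (r₀ + A * ∑ k ∈ Finset.range n, (w k).im) / n := by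
        gcongr
        exact (hlower n).trans (mul_le_mul_of_nonneg_left (hupper n) hB)
      _ = _ := by ring
  have hlim := ((tendsto_const_div_atTop_nhds_zero_nat r₀).add (hl.cesaro.const_mul A)).const_mul B
  have hbound : 1 ≤ B * A * l := by
    simpa [mul_assoc] using ge_of_tendsto hlim hmean
  exact pos_of_mul_pos_right (zero_lt_one.trans_le hbound) (by positivity)

end IsBISBS

theorem theorem1p19_general (φ : ℂ → ℂ) (hφ : IsHeightRaising φ) (hI : IsTypeI φ)
    (w : ℕ → ℂ) (hw : IsBISBS φ w) (hinf : Tendsto w atTop (Bornology.cobounded ℂ)) :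
    Antitone (fun n => (w n).im) ∧
      ∃ l : ℝ, 0 < l ∧ Tendsto (fun n => (w n).im) atTop (𝓝 l) := by
  have hbdd : BddBelow (Set.range fun n => (w n).im) :=
    ⟨0, Set.forall_mem_range.mpr fun n => le_of_lt (hw.mem n)⟩
  have hlim := tendsto_atTop_ciInf (hw.antitone_im hφ) hbdd
  exact ⟨hw.antitone_im hφ, _, hw.limit_im_pos hφ hI hinf hlim, hlim⟩

theorem theorem1p19 (φ : ℂ → ℂ) (hφ : IsParabolicSelfMap φ) (hI : IsTypeI φ)
    (w : ℕ → ℂ) (hw : IsBISBS φ w) (hinf : Tendsto w atTop (Bornology.cobounded ℂ)) :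
    Antitone (fun n => (w n).im) ∧
      ∃ l : ℝ, 0 < l ∧ Tendsto (fun n => (w n).im) atTop (𝓝 l) :=
  theorem1p19_general φ hφ.isHeightRaising hI w hw hinf
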